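/- Let $K$ be a field and let $L/L_0$ be a finite separable extension of fields containing $K$. For an intermediate field $K\subseteq E_0\subseteq L_0$, say that $L/L_0$ is *defined over* $E_0$ if there is a field $E$ with $E_0\subseteq E\subseteq L$, $[E:E_0]=[L:L_0]$ and $L=EL_0$. The essential dimension $\mathrm{ed}_K(L/L_0)$ is the minimum of $\mathrm{trdeg}_K E_0$ over all $E_0$ over which $L/L_0$ is defined. For a finite group $G$ put $\mathrm{ed}_K(G)=\mathrm{ed}_K\big(K(V)/K(V)^G\big)$, where $G\to GL(V)$ is a faithful finite-dimensional representation over $K$ and $K(V)$ is the function field of the affine space $V$, with the induced action of $G$. **Proposition.** (1) $\mathrm{ed}_{\mathbb F_2}\big((\mathbb Z/2\mathbb Z)^2\big)=2$. (2) If $K$ is a field with $\mathrm{char}\,K=2$ and $|K|\ge 4$, then $\mathrm{ed}_K\big((\mathbb Z/2\mathbb Z)^2\big)=1$. In both parts the stated value holds for the regular representation and for every other choice of the faithful representation $V$. -/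

import Mathlib

/-- Let `L₀` be an intermediate field of `L / K`. The extension `L / L₀` is *defined over* the
intermediate field `E₀` of `L / K` if `E₀ ⊆ L₀` and there is a field `E` with `E₀ ⊆ E ⊆ L`,
`[E : E₀] = [L : L₀]` and `E L₀ = L`. -/
def ExtensionDefinedOver {K L : Type*} [Field K] [Field L] [Algebra K L]
    (L₀ E₀ : IntermediateField K L) : Prop :=
  E₀ ≤ L₀ ∧ ∃ E : IntermediateField K L, E₀ ≤ E ∧
    IntermediateField.relfinrank E₀ E = Module.finrank L₀ L ∧ E ⊔ L₀ = ⊤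

/-- The essential dimension `ed_K(L / L₀)` of a finite separable extension `L / L₀` of fields
containing `K`: the minimum of the transcendence degrees over `K` of the intermediate fields over
which `L / L₀` is defined. The set is never empty, as it contains `trdeg_K L₀` (take `E₀ = L₀` and
`E = L`), so the infimum of cardinals is a minimum. -/
noncomputable def extensionEssDim (K : Type*) {L : Type*} [Field K] [Field L] [Algebra K L]
    (L₀ : IntermediateField K L) : Cardinal :=
  sInf {d | ∃ E₀ : IntermediateField K L, ExtensionDefinedOver L₀ E₀ ∧ d = Algebra.trdeg K E₀}

/-- The function field `K(V)` of the affine space `V`: the field of fractions of the ring `K[V]` of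
polynomial functions, that is, of the symmetric algebra of the dual space of `V`. A basis
`x₁, …, xₙ` of the dual space identifies it with `K(x₁, …, xₙ)`. -/
abbrev AffineFunctionField (K V : Type*) [Field K] [AddCommGroup V] [Module K V] : Type _ :=
  FractionRing (SymmetricAlgebra K (Module.Dual K V))

section Action

variable {K G V : Type*} [Field K] [Group G] [AddCommGroup V] [Module K V]

/-- The action of `G` on the polynomial functions on `V` by `K`-algebra automorphisms that extends
the dual representation on the linear forms, `(g • f)(v) = f(g⁻¹ v)`. -/
noncomputable def polynomialFunctionAction (ρ : Representation K G V) :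
    G →* (SymmetricAlgebra K (Module.Dual K V) ≃ₐ[K] SymmetricAlgebra K (Module.Dual K V)) where
  toFun g := AlgEquiv.ofAlgHom
    (SymmetricAlgebra.lift (SymmetricAlgebra.ι K (Module.Dual K V) ∘ₗ ρ.dual g))
    (SymmetricAlgebra.lift (SymmetricAlgebra.ι K (Module.Dual K V) ∘ₗ ρ.dual g⁻¹))
    (by
      apply SymmetricAlgebra.algHom_ext
      ext f
      have h := LinearMap.congr_fun (map_mul ρ.dual g g⁻¹) f
      rw [mul_inv_cancel, map_one] at h
      change SymmetricAlgebra.lift _ (SymmetricAlgebra.lift _ (SymmetricAlgebra.ι K _ f)) =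
        SymmetricAlgebra.ι K _ f
      simp only [SymmetricAlgebra.lift_ι_apply, LinearMap.comp_apply]
      exact congrArg (SymmetricAlgebra.ι K _) h.symm)
    (by
      apply SymmetricAlgebra.algHom_ext
      ext f
      have h := LinearMap.congr_fun (map_mul ρ.dual g⁻¹ g) f
      rw [inv_mul_cancel, map_one] at h
      change SymmetricAlgebra.lift _ (SymmetricAlgebra.lift _ (SymmetricAlgebra.ι K _ f)) =
        SymmetricAlgebra.ι K _ f
      simp only [SymmetricAlgebra.lift_ι_apply, LinearMap.comp_apply]
      exact congrArg (SymmetricAlgebra.ι K _) h.symm)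
  map_one' := by
    apply AlgEquiv.coe_toAlgHom_injective
    apply SymmetricAlgebra.algHom_ext
    ext f
    change SymmetricAlgebra.lift _ (SymmetricAlgebra.ι K _ f) = SymmetricAlgebra.ι K _ f
    rw [SymmetricAlgebra.lift_ι_apply, LinearMap.comp_apply, map_one]
    rfl
  map_mul' g h := by
    apply AlgEquiv.coe_toAlgHom_injective
    apply SymmetricAlgebra.algHom_ext
    ext f
    change SymmetricAlgebra.lift _ (SymmetricAlgebra.ι K _ f) =
      SymmetricAlgebra.lift _ (SymmetricAlgebra.lift _ (SymmetricAlgebra.ι K _ f))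
    simp only [SymmetricAlgebra.lift_ι_apply, LinearMap.comp_apply, map_mul]
    rfl

/-- The induced action of `G` on `K(V)` by `K`-automorphisms. -/
noncomputable def functionFieldAction (ρ : Representation K G V) :
    G →* (AffineFunctionField K V ≃ₐ[K] AffineFunctionField K V) :=
  (IsFractionRing.fieldEquivOfAlgEquivHom K (AffineFunctionField K V)).comp
    (polynomialFunctionAction ρ)

/-- The field of invariants `K(V)^G`. -/
noncomputable def invariantField (ρ : Representation K G V) :
    IntermediateField K (AffineFunctionField K V) :=
  IntermediateField.fixedField (functionFieldAction ρ).range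

/-- `ed_K(K(V) / K(V)^G)` for a representation of `G` on `V`. -/
noncomputable def representationEssDim (ρ : Representation K G V) : Cardinal :=
  extensionEssDim K (invariantField ρ)

end Action

/-- The essential dimension `ed_K(G)` of a finite group `G`: the essential dimension of
`K(V) / K(V)^G` for the regular representation `V = K[G]`, which is faithful. -/
noncomputable def groupEssDim (K G : Type*) [Field K] [Group G] : Cardinal :=
  representationEssDim (Representation.leftRegular K G)

/-! Upper bounds: by additive Hilbert 90, an additive character `χ : G → K` is realised by some `z`
in `L` with `g z = z + χ g`. If characters `χ₁, …, χₙ` have trivial common kernel, `K(z₁, …, zₙ)` is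
stable with faithful action, so the extension descends to its invariants and `n` bounds the
essential dimension. The two coordinates serve over `𝔽₂`; when `|K| ≥ 4` the Klein group embeds in
`(K, +)` and one character suffices.

Lower bounds: if the extension is defined over `E₀` algebraic over `K(x)`, with `x ∈ E₀`, then `G`
acts faithfully on the algebraic closure `M` of `K(x)` in `K(V)`
(`exists_stable_of_extensionDefinedOver`). Transcendence degree 0 would force `M = K`. For degree 1
over `𝔽₂`, specialization embeds `M` in `𝔽₂(t)` (`exists_algHom_ratFunc`), so `M ≅ 𝔽₂(t)` by Lüroth.
But `Aut 𝔽₂(t) = PGL₂(𝔽₂) ≅ S₃` has no Klein subgroup. -/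

open IntermediateField

/-! ### Descent along stable subfields and the upper bound -/

section GaloisAction

variable {K L G : Type*} [Field K] [Field L] [Algebra K L] [Group G]

/-- The restriction of an action on a field to a stable intermediate field. -/
noncomputable def restrictAction (θ : G →* (L ≃ₐ[K] L)) (E : IntermediateField K L)
    (hE : ∀ g, ∀ x ∈ E, θ g x ∈ E) : G →* (E ≃ₐ[K] E) where
  toFun g := AlgEquiv.ofAlgHom
    (((θ g).toAlgHom.comp E.val).codRestrict E.toSubalgebra fun x => hE g x x.2)
    (((θ g⁻¹).toAlgHom.comp E.val).codRestrict E.toSubalgebra fun x => hE g⁻¹ x x.2)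
    (by
      ext x
      change θ g (θ g⁻¹ x) = x
      rw [← AlgEquiv.mul_apply, ← map_mul, mul_inv_cancel, map_one, AlgEquiv.one_apply])
    (by
      ext x
      change θ g⁻¹ (θ g x) = x
      rw [← AlgEquiv.mul_apply, ← map_mul, inv_mul_cancel, map_one, AlgEquiv.one_apply])
  map_one' := by
    ext x
    change θ 1 x = x
    simp
  map_mul' g h := by
    ext x
    change θ (g * h) x = θ g (θ h x)
    simp

theorem coe_restrictAction (θ : G →* (L ≃ₐ[K] L)) (E : IntermediateField K L)
    (hE : ∀ g, ∀ x ∈ E, θ g x ∈ E) (g : G) (x : E) :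
    (restrictAction θ E hE g x : L) = θ g x := rfl

theorem mem_fixedField_range {θ : G →* (L ≃ₐ[K] L)} {x : L} :
    x ∈ fixedField θ.range ↔ ∀ g, θ g x = x := by
  rw [mem_fixedField_iff]
  exact ⟨fun h g => h _ ⟨g, rfl⟩, by rintro h _ ⟨g, rfl⟩; exact h g⟩

theorem stable_adjoin (θ : G →* (L ≃ₐ[K] L)) (S : Set L)
    (hS : ∀ g, ∀ x ∈ S, θ g x ∈ adjoin K S) (g : G) : ∀ x ∈ adjoin K S, θ g x ∈ adjoin K S := by
  have h : adjoin K S ≤ (adjoin K S).comap (θ g).toAlgHom :=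
    adjoin_le_iff.2 fun x hx => hS g x hx
  exact fun x hx => h hx

/-- Artin's theorem for the restricted action, whose fixed field is the trace on `E` of the whole
fixed field. -/
theorem relfinrank_fixedField [Finite G] (θ : G →* (L ≃ₐ[K] L)) (E : IntermediateField K L)
    (hE : ∀ g, ∀ x ∈ E, θ g x ∈ E) (hf : ∀ g, (∀ x ∈ E, θ g x = x) → g = 1) :
    relfinrank (fixedField θ.range) E = Nat.card G := by
  have hinj : Function.Injective (restrictAction θ E hE) := by
    rw [injective_iff_map_eq_one]
    intro g hg
    refine hf g fun x hx => ?_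
    exact congrArg Subtype.val (DFunLike.congr_fun hg (⟨x, hx⟩ : E))
  have h1 : (fixedField θ.range).comap E.val = fixedField (restrictAction θ E hE).range := by
    ext x
    rw [mem_fixedField_range]
    change (x : L) ∈ fixedField θ.range ↔ _
    rw [mem_fixedField_range]
    exact forall_congr' fun g => by rw [Subtype.ext_iff, coe_restrictAction]
  have h2 := finrank_comap (A := fixedField θ.range) E.val
  have : Finite (restrictAction θ E hE).range :=
    Finite.of_surjective _ (restrictAction θ E hE).rangeRestrict_surjective
  rw [fieldRange_val, h1] at h2
  have := Fintype.ofFinite (restrictAction θ E hE).range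
  have h3 := FixedPoints.finrank_eq_card (restrictAction θ E hE).range E
  rw [← Nat.card_eq_fintype_card] at h3
  rw [← h2]
  refine Eq.trans h3 ?_
  exact (Nat.card_congr (MonoidHom.ofInjective hinj).toEquiv).symm

theorem finrank_fixedField_range [Finite G] {θ : G →* (L ≃ₐ[K] L)} (hθ : Function.Injective θ) :
    Module.finrank (fixedField θ.range) L = Nat.card G := by
  rw [← relfinrank_top_right]
  refine relfinrank_fixedField θ (⊤ : IntermediateField K L) (fun _ _ _ => trivial) fun g hg => hθ (?_ : θ g = θ 1)
  rw [map_one]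
  ext x
  exact hg x trivial

/-- A stable intermediate field with faithful action descends the extension. -/
theorem extensionDefinedOver_inf_fixedField [Finite G] {θ : G →* (L ≃ₐ[K] L)}
    (hθ : Function.Injective θ) (E : IntermediateField K L)
    (hE : ∀ g, ∀ x ∈ E, θ g x ∈ E) (hf : ∀ g, (∀ x ∈ E, θ g x = x) → g = 1) :
    ExtensionDefinedOver (fixedField θ.range) (E ⊓ fixedField θ.range) := by
  refine ⟨inf_le_right, E, inf_le_left, ?_, ?_⟩
  · rw [finrank_fixedField_range hθ, ← relfinrank_fixedField θ E hE hf, inf_comm,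
      inf_relfinrank_right]
  · set L₀ := fixedField θ.range
    have hM : ∀ g, ∀ x ∈ E ⊔ L₀, θ g x ∈ E ⊔ L₀ := by
      intro g
      have : E ⊔ L₀ ≤ (E ⊔ L₀).comap (θ g).toAlgHom := by
        refine sup_le (fun x hx => ?_) fun x hx => ?_
        · exact (le_sup_left : E ≤ E ⊔ L₀) (hE g x hx)
        · change θ g x ∈ E ⊔ L₀
          rw [mem_fixedField_range.1 hx g]
          exact (le_sup_right : L₀ ≤ E ⊔ L₀) hx
      exact fun x hx => this hx
    -- The compositum is again stable with faithful action, so it has degree `|G|` over `L₀`, as `L`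
    -- has.
    have h1 := relfinrank_fixedField θ (E ⊔ L₀) hM
      fun g hg => hf g fun x hx => hg x ((le_sup_left : E ≤ E ⊔ L₀) hx)
    have h2 := relfinrank_mul_finrank_top (le_sup_right : L₀ ≤ E ⊔ L₀)
    rw [h1, finrank_fixedField_range hθ] at h2
    have h3 : Module.finrank ↥(E ⊔ L₀) L = 1 :=
      Nat.eq_of_mul_eq_mul_left Nat.card_pos (h2.trans (mul_one _).symm)
    exact finrank_eq_one_iff_eq_top.1 h3

/-- Dedekind independence gives a nonzero trace; it is invariant, so one may divide by it. -/
theorem exists_sum_action_eq_one [Fintype G] {θ : G →* (L ≃ₐ[K] L)} (hθ : Function.Injective θ) :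
    ∃ w : L, ∑ g, θ g w = 1 := by
  have hli : LinearIndependent L (fun g : G => ((θ g : L →* L) : L → L)) :=
    (linearIndependent_monoidHom L L).comp (fun g : G => (θ g : L →* L)) fun g h hgh =>
      hθ (AlgEquiv.ext fun x => DFunLike.congr_fun hgh x)
  obtain ⟨w, hw⟩ : ∃ w : L, ∑ g, θ g w ≠ 0 := by
    by_contra! h
    have := Fintype.linearIndependent_iff.1 hli (fun _ => 1) (by
      ext x
      simpa using h x) 1
    exact one_ne_zero this
  have hinv : ∀ g, θ g (∑ h, θ h w) = ∑ h, θ h w := by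
    intro g
    rw [map_sum]
    refine Fintype.sum_equiv (Equiv.mulLeft g) _ _ fun h => ?_
    simp
  refine ⟨w * (∑ h, θ h w)⁻¹, ?_⟩
  simp only [map_mul, map_inv₀, hinv]
  rw [← Finset.sum_mul, mul_inv_cancel₀ hw]

/-- The additive form of Hilbert's theorem 90 for homomorphisms to the ground field. -/
theorem exists_action_eq_add [Finite G] {θ : G →* (L ≃ₐ[K] L)} (hθ : Function.Injective θ)
    (χ : G → K) (hχ : ∀ g h, χ (g * h) = χ g + χ h) :
    ∃ z : L, ∀ g, θ g z = z + algebraMap K L (χ g) := by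
  have := Fintype.ofFinite G
  obtain ⟨w, hw⟩ := exists_sum_action_eq_one hθ
  refine ⟨-∑ h, algebraMap K L (χ h) * θ h w, fun g => ?_⟩
  -- Reindexing by `h ↦ g * h` and splitting `χ (g * h)` leaves `χ g` times the trace of `w`, which
  -- is 1.
  have h1 : ∑ h, algebraMap K L (χ (g * h)) * θ (g * h) w =
      ∑ h, algebraMap K L (χ h) * θ h w :=
    Fintype.sum_equiv (Equiv.mulLeft g) _ _ fun h => rfl
  have h2 : ∑ h, θ (g * h) w = 1 := by
    rw [← hw]
    exact Fintype.sum_equiv (Equiv.mulLeft g) _ _ fun h => rfl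
  simp only [hχ, map_add, add_mul, Finset.sum_add_distrib, ← Finset.mul_sum, h2] at h1
  simp only [map_neg, map_sum, map_mul, AlgEquiv.commutes] at h1 ⊢
  rw [← h1]
  simp

theorem trdeg_adjoin_le (S : Set L) : Algebra.trdeg K (adjoin K S) ≤ Cardinal.mk S := by
  let T : Set (adjoin K S) := Subtype.val ⁻¹' S
  have hT : adjoin K T = ⊤ := by
    apply_fun IntermediateField.map (adjoin K S).val using map_injective _
    rw [adjoin_map, ← AlgHom.fieldRange_eq_map, fieldRange_val]
    congr 1
    ext x
    constructor
    · rintro ⟨y, hy, rfl⟩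
      exact hy
    · exact fun hx => ⟨⟨x, subset_adjoin K S hx⟩, hx, rfl⟩
  have : Algebra.IsAlgebraic (Algebra.adjoin K T) (adjoin K S) := by
    rw [← isAlgebraic_adjoin_iff_top, hT]
    infer_instance
  refine (Algebra.IsAlgebraic.trdeg_le_cardinalMk K T).trans ?_
  exact Cardinal.mk_le_of_injective (f := fun t : T => (⟨t.1, t.2⟩ : S))
    fun a b h => Subtype.ext (Subtype.ext (by simpa using h))

theorem extensionEssDim_le_of_characters [Finite G] {θ : G →* (L ≃ₐ[K] L)}
    (hθ : Function.Injective θ) (n : ℕ) (χ : Fin n → G → K)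
    (hχ : ∀ i g h, χ i (g * h) = χ i g + χ i h) (hf : ∀ g, (∀ i, χ i g = 0) → g = 1) :
    extensionEssDim K (fixedField θ.range) ≤ n := by
  choose z hz using fun i => exists_action_eq_add hθ (χ i) (hχ i)
  set E := adjoin K (Set.range z)
  have hzE : ∀ i, z i ∈ E := fun i => subset_adjoin K _ ⟨i, rfl⟩
  have h1 := extensionDefinedOver_inf_fixedField hθ E
    (stable_adjoin θ _ (by
      rintro g _ ⟨i, rfl⟩
      rw [hz]
      exact add_mem (hzE i) (IntermediateField.algebraMap_mem _ _)))
    (fun g hg => hf g fun i => by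
      have := hg _ (hzE i)
      rw [hz] at this
      simpa using this)
  refine le_trans (csInf_le' ⟨E ⊓ fixedField θ.range, h1, rfl⟩) ?_
  refine (trdeg_le_of_injective (inclusion (inf_le_left : E ⊓ fixedField θ.range ≤ E))
    (inclusion (inf_le_left : E ⊓ fixedField θ.range ≤ E)).toRingHom.injective).trans ?_
  refine (trdeg_adjoin_le _).trans ?_
  have := Cardinal.mk_range_le_lift (f := z)
  simpa using this

end GaloisAction

/-! ### No Klein four-group acts faithfully on a subfield of `𝔽₂(t)` -/

section KleinFourMoebius

/-- The three maps are the transpositions of `PGL₂(𝔽₂) ≅ S₃`; the product of two distinct ones is a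
3-cycle, never a transposition. -/
theorem false_of_moebius_involutions {F : Type*} [Field F] [CharP F 2] {x : F} (hx : x ≠ 0)
    (hx1 : x + 1 ≠ 0) (σ : F →+* F) {u v : F} (hu : σ x = u) (huv : u ≠ v)
    (h1 : u = x + 1 ∨ u = x⁻¹ ∨ u = x / (x + 1)) (h2 : v = x + 1 ∨ v = x⁻¹ ∨ v = x / (x + 1))
    (h3 : σ v = x + 1 ∨ σ v = x⁻¹ ∨ σ v = x / (x + 1)) : False := by
  have h20 : (2 : F) = 0 := CharTwo.two_eq_zero
  rcases h1 with rfl | rfl | rfl <;> rcases h2 with rfl | rfl | rfl <;>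
    first
    | exact huv rfl
    | (simp only [map_add, map_one, map_inv₀, map_div₀, hu] at h3
       rcases h3 with h | h | h <;> grind)

instance charP_ratFunc_two : CharP (RatFunc (ZMod 2)) 2 :=
  charP_of_injective_algebraMap (algebraMap (ZMod 2) (RatFunc (ZMod 2))).injective 2

theorem ratFunc_X_add_one_ne_zero {K : Type*} [Field K] : (RatFunc.X + 1 : RatFunc K) ≠ 0 := by
  have h := RatFunc.algebraMap_ne_zero (Polynomial.X_add_C_ne_zero (1 : K))
  simpa [RatFunc.algebraMap_X] using h

theorem ratFunc_X_sq_add_X_add_one_ne_zero {K : Type*} [Field K] :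
    (RatFunc.X ^ 2 + RatFunc.X + 1 : RatFunc K) ≠ 0 := by
  have h0 : (Polynomial.X ^ 2 + Polynomial.X + 1 : Polynomial K) ≠ 0 := by
    intro h
    simpa using congrArg (Polynomial.eval 0) h
  have h := RatFunc.algebraMap_ne_zero h0
  simpa [RatFunc.algebraMap_X] using h

theorem ratFunc_algEquiv_eq_one {K : Type*} [Field K] {σ : RatFunc K ≃ₐ[K] RatFunc K}
    (h : σ RatFunc.X = RatFunc.X) : σ = 1 := by
  have hp : ∀ p : Polynomial K, σ (algebraMap _ _ p) = algebraMap _ _ p := by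
    have : σ.toAlgHom.comp (IsScalarTower.toAlgHom K (Polynomial K) (RatFunc K)) =
        IsScalarTower.toAlgHom K (Polynomial K) (RatFunc K) := by
      apply Polynomial.algHom_ext
      simpa [RatFunc.algebraMap_X] using h
    exact fun p => DFunLike.congr_fun this p
  ext x
  rw [← RatFunc.num_div_denom x, map_div₀, hp, hp, AlgEquiv.one_apply]

theorem algEquiv_ratFunc_X_cases (σ : RatFunc (ZMod 2) ≃ₐ[ZMod 2] RatFunc (ZMod 2)) :
    let x : RatFunc (ZMod 2) := RatFunc.X
    σ x = x ∨ (σ x = x + 1 ∨ σ x = x⁻¹ ∨ σ x = x / (x + 1)) ∨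
      σ x = (x + 1)⁻¹ ∨ σ x = (x + 1) / x := by
  intro x
  set u := σ x with hu
  have hx : x ≠ 0 := RatFunc.X_ne_zero
  have hx1 : x + 1 ≠ 0 := ratFunc_X_add_one_ne_zero
  -- A generator of `𝔽₂(x)` has numerator and denominator of degree at most 1, leaving sixteen
  -- coefficient choices.
  have htop : (ZMod 2)⟮u⟯ = ⊤ := by
    have := congrArg (IntermediateField.map σ.toAlgHom) (RatFunc.adjoin_X (K := ZMod 2))
    rw [adjoin_map, Set.image_singleton, ← AlgHom.fieldRange_eq_map] at this
    refine this.trans ?_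
    exact AlgHom.fieldRange_eq_top.2 σ.surjective
  have hdeg := RatFunc.finrank_eq_max_natDegree u
  rw [htop, IntermediateField.finrank_top] at hdeg
  obtain ⟨b, c, hnum⟩ := Polynomial.exists_eq_X_add_C_of_natDegree_le_one
    (p := u.num) (hdeg ▸ le_max_left _ _)
  obtain ⟨d, e, hden⟩ := Polynomial.exists_eq_X_add_C_of_natDegree_le_one
    (p := u.denom) (hdeg ▸ le_max_right _ _)
  have huq := RatFunc.num_div_denom u
  have hu0 : u ≠ 0 := by simpa [hu] using hx
  have hu1 : u ≠ 1 := by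
    intro h
    have : x = 1 := σ.injective (by rw [← hu, h, map_one])
    exact hx1 (by rw [this, CharTwo.add_self_eq_zero])
  rw [hnum, hden] at huq
  -- Degenerate choices give `u = 0` or `u = 1`; a zero denominator also gives `u = 0`.
  have h01 : ∀ a : ZMod 2, a = 0 ∨ a = 1 := by decide
  rcases h01 b with rfl | rfl <;> rcases h01 c with rfl | rfl <;> rcases h01 d with rfl | rfl <;>
    rcases h01 e with rfl | rfl <;> simp [RatFunc.algebraMap_X] at huq <;> grind

theorem algEquiv_ratFunc_X_of_involution {σ : RatFunc (ZMod 2) ≃ₐ[ZMod 2] RatFunc (ZMod 2)}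
    (h1 : σ ≠ 1) (h2 : σ * σ = 1) :
    let x : RatFunc (ZMod 2) := RatFunc.X
    σ x = x + 1 ∨ σ x = x⁻¹ ∨ σ x = x / (x + 1) := by
  intro x
  have hx : x ≠ 0 := RatFunc.X_ne_zero
  have hx1 : x + 1 ≠ 0 := ratFunc_X_add_one_ne_zero
  have hx2 : x ^ 2 + x + 1 ≠ 0 := ratFunc_X_sq_add_X_add_one_ne_zero
  have h20 : (2 : RatFunc (ZMod 2)) = 0 := CharTwo.two_eq_zero
  have hs : σ (σ x) = x := DFunLike.congr_fun h2 x
  rcases algEquiv_ratFunc_X_cases σ with h | h | h | h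
  · exact absurd (ratFunc_algEquiv_eq_one h) h1
  · exact h
  -- The two remaining maps have order 3: being an involution would force `x ^ 2 + x + 1 = 0`.
  all_goals
    change σ x = _ at h
    rw [h] at hs
    simp only [map_add, map_one, map_inv₀, map_div₀] at hs
    exfalso
    grind

theorem not_injective_kleinFour_ratFunc
    (θ : Multiplicative (ZMod 2 × ZMod 2) →* (RatFunc (ZMod 2) ≃ₐ[ZMod 2] RatFunc (ZMod 2))) :
    ¬ Function.Injective θ := by
  intro hθ
  have key : ∀ g : Multiplicative (ZMod 2 × ZMod 2), g ≠ 1 → _ := fun g hg =>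
    algEquiv_ratFunc_X_of_involution (σ := θ g)
      (fun h => hg (hθ (h.trans (map_one θ).symm)))
      (by
        rw [← map_mul, ← map_one θ]
        congr 1
        revert g
        decide)
  let g : Multiplicative (ZMod 2 × ZMod 2) := Multiplicative.ofAdd (1, 0)
  let h : Multiplicative (ZMod 2 × ZMod 2) := Multiplicative.ofAdd (0, 1)
  have h3 := key (g * h) (by decide)
  rw [map_mul] at h3
  refine false_of_moebius_involutions RatFunc.X_ne_zero ratFunc_X_add_one_ne_zero
    (θ g : RatFunc (ZMod 2) →+* RatFunc (ZMod 2)) (u := θ g RatFunc.X) (v := θ h RatFunc.X) rfl ?_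
    (key g (by decide)) (key h (by decide)) h3
  intro heq
  have h4 : θ (g⁻¹ * h) RatFunc.X = RatFunc.X := by
    rw [map_mul, AlgEquiv.mul_apply, ← heq, ← AlgEquiv.mul_apply, ← map_mul, inv_mul_cancel,
      map_one, AlgEquiv.one_apply]
  have h5 := hθ ((ratFunc_algEquiv_eq_one h4).trans (map_one θ).symm)
  exact absurd h5 (by decide)

/-- By Lüroth, `M` is either `𝔽₂`, which has no nontrivial automorphism, or isomorphic to `𝔽₂(t)`.
-/
theorem not_injective_kleinFour_of_algHom_ratFunc {M : Type*} [Field M] [Algebra (ZMod 2) M]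
    (j : M →ₐ[ZMod 2] RatFunc (ZMod 2))
    (θ : Multiplicative (ZMod 2 × ZMod 2) →* (M ≃ₐ[ZMod 2] M)) : ¬ Function.Injective θ := by
  intro hinj
  let e₁ : M ≃ₐ[ZMod 2] j.fieldRange := AlgEquiv.ofInjectiveField j
  have hbot : j.fieldRange ≠ ⊥ := by
    intro hb
    have h4 : ∀ m : M, ∃ c, algebraMap (ZMod 2) M c = m := by
      intro m
      have : j m ∈ j.fieldRange := ⟨m, rfl⟩
      rw [hb] at this
      obtain ⟨c, hc⟩ := mem_bot.1 this
      exact ⟨c, j.toRingHom.injective ((j.commutes c).trans hc)⟩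
    obtain ⟨g, hg⟩ := exists_ne (1 : Multiplicative (ZMod 2 × ZMod 2))
    refine hg (hinj ?_)
    rw [map_one]
    ext m
    obtain ⟨c, rfl⟩ := h4 m
    rw [AlgEquiv.commutes, AlgEquiv.commutes]
  let e : M ≃ₐ[ZMod 2] RatFunc (ZMod 2) := e₁.trans (RatFunc.Luroth.algEquiv hbot).symm
  exact not_injective_kleinFour_ratFunc ((AlgEquiv.autCongr e).toMonoidHom.comp θ)
    ((AlgEquiv.autCongr e).injective.comp hinj)

end KleinFourMoebius

/-! ### Specialization of algebraic closures -/

section Specialization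

variable {K R L F : Type*} [Field K] [CommRing R] [IsDomain R] [Algebra K R] [Field L] [Algebra K L]
  [Algebra R L] [IsScalarTower K R L] [IsFractionRing R L] [Field F] [Algebra K F]

/-- If `f : R → F` is defined at `x = p / q` with transcendental value, then the algebraic closure
of `K(x)` in the fraction field of the integrally closed domain `R` embeds into `F`. -/
theorem exists_algHom_of_isAlgebraic [IsIntegrallyClosed R] (f : R →ₐ[K] F) {p q : R}
    (hq : f q ≠ 0) (hx : Transcendental K (f p / f q)) (M : IntermediateField K L)
    (hM : ∀ m ∈ M, IsAlgebraic K⟮algebraMap R L p / algebraMap R L q⟯ m) :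
    Nonempty (M →ₐ[K] F) := by
  set x := algebraMap R L p / algebraMap R L q with hxdef
  have : (RingHom.ker f).IsPrime := RingHom.ker_isPrime f
  -- `B` is the local ring at the prime `ker f`; `f` extends to it, and elements with nonzero value
  -- are invertible in it.
  set S := (RingHom.ker f).primeCompl with hS
  have hS0 : S ≤ nonZeroDivisors R := Ideal.primeCompl_le_nonZeroDivisors _
  set B := Localization.subalgebra.ofField L S hS0 with hB
  have hunit : ∀ s : S, IsUnit (f.toRingHom s) := fun s =>
    isUnit_iff_ne_zero.2 fun h => s.2 (RingHom.mem_ker.2 h)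
  let φ : B →+* F := IsLocalization.lift (M := S) hunit
  have hφ : ∀ r : R, φ (algebraMap R B r) = f r := fun r => IsLocalization.lift_eq hunit r
  have hBK : ∀ c : K, algebraMap K L c ∈ B := fun c => by
    rw [IsScalarTower.algebraMap_apply K R L]
    exact B.algebraMap_mem _
  let B' : Subalgebra K L := B.restrictScalars K
  let φ' : B' →ₐ[K] F := ⟨φ, fun c => by
    rw [← f.commutes c]
    rw [← hφ (algebraMap K R c)]
    exact congrArg φ (Subtype.ext (IsScalarTower.algebraMap_apply K R L c))⟩
  have hφ' : ∀ r : R, φ' ⟨algebraMap R L r, B.algebraMap_mem r⟩ = f r := hφ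
  have hinv : ∀ b : B', φ' b ≠ 0 → (b : L)⁻¹ ∈ B' := by
    intro b hb
    obtain ⟨a, s, hs, h⟩ := b.2
    have hs0 : algebraMap R L s ≠ 0 := by
      rw [Ne, IsFractionRing.to_map_eq_zero_iff]
      exact nonZeroDivisors.ne_zero (hS0 hs)
    have h1 : b * ⟨algebraMap R L s, B.algebraMap_mem s⟩ =
        ⟨algebraMap R L a, B.algebraMap_mem a⟩ := by
      apply Subtype.ext
      change (b : L) * algebraMap R L s = algebraMap R L a
      rw [h, inv_mul_cancel_right₀ hs0]
    have h2 := congrArg φ' h1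
    rw [map_mul, hφ', hφ'] at h2
    have ha : f a ≠ 0 := by
      rw [← h2]
      exact mul_ne_zero hb fun h => hs (RingHom.mem_ker.2 h)
    refine ⟨s, a, fun h => ha (RingHom.mem_ker.1 h), ?_⟩
    rw [h, mul_inv, inv_inv, mul_comm]
  have hqS : q ∈ S := fun h => hq (RingHom.mem_ker.1 h)
  have hxB : x ∈ B' := ⟨p, q, hqS, div_eq_mul_inv _ _⟩
  have hφx : φ' ⟨x, hxB⟩ = f p / f q := by
    have hq0 : algebraMap R L q ≠ 0 := by
      rw [Ne, IsFractionRing.to_map_eq_zero_iff]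
      exact nonZeroDivisors.ne_zero (hS0 hqS)
    have h1 : (⟨x, hxB⟩ : B') * ⟨algebraMap R L q, B.algebraMap_mem q⟩ =
        ⟨algebraMap R L p, B.algebraMap_mem p⟩ :=
      Subtype.ext (div_mul_cancel₀ _ hq0)
    rw [eq_div_iff hq, ← hφ' q, ← hφ' p, ← map_mul, h1]
  -- A nonzero polynomial in `x` has nonzero value, since the value of `x` is transcendental.
  have hKx : ∀ y ∈ K⟮x⟯, y ∈ B' := by
    intro y hy
    obtain ⟨r, s, rfl⟩ := (mem_adjoin_simple_iff K y).1 hy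
    have haev : ∀ r : Polynomial K, Polynomial.aeval x r =
        ((Polynomial.aeval (⟨x, hxB⟩ : B') r : B') : L) := fun r =>
      Polynomial.aeval_algHom_apply B'.val (⟨x, hxB⟩ : B') r
    by_cases hs : s = 0
    · simp [hs, zero_mem]
    rw [haev, haev, div_eq_mul_inv]
    refine mul_mem (Subtype.prop _) (hinv _ ?_)
    rw [← Polynomial.aeval_algHom_apply, hφx]
    exact fun h => hs (transcendental_iff.1 hx s h)
  -- `M` is algebraic over a field inside `B`, hence integral over the integrally closed `B`.
  have hMB : M.toSubalgebra ≤ B' := by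
    intro m hm
    let i : K⟮x⟯ →+* B := Subring.inclusion (S := K⟮x⟯.toSubfield.toSubring) (T := B.toSubring) hKx
    have hint : IsIntegral B m := by
      have h1 : IsIntegral K⟮x⟯ m := (hM m hm).isIntegral
      obtain ⟨P, hP, hPm⟩ := h1
      refine ⟨P.map i, hP.map i, ?_⟩
      rw [Polynomial.eval₂_map]
      exact hPm
    have : IsIntegrallyClosed B := isIntegrallyClosed_of_isLocalization B S hS0
    obtain ⟨b, rfl⟩ := IsIntegrallyClosed.isIntegral_iff.1 hint
    exact b.2
  exact ⟨φ'.comp (Subalgebra.inclusion hMB)⟩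

/-- A field is algebraically closed in the fraction field of an integrally closed algebra with a
rational point. -/
theorem mem_bot_of_isAlgebraic [IsIntegrallyClosed R] (ε : R →ₐ[K] K) {x : L}
    (hx : IsAlgebraic K x) : x ∈ (⊥ : IntermediateField K L) := by
  obtain ⟨r, rfl⟩ := IsIntegrallyClosed.isIntegral_iff.1 (hx.isIntegral.tower_top (A := R))
  -- Vanishing at the rational point kills the constant term of the minimal polynomial of `y`, so `y
  -- = 0`.
  set y := r - algebraMap K R (ε r) with hy
  have hεy : ε y = 0 := by simp [hy]
  have hyint : IsIntegral K y := by
    refine IsIntegral.sub ?_ isIntegral_algebraMap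
    exact (isIntegral_algebraMap_iff (IsFractionRing.injective R L)).1 hx.isIntegral
  have hy0 : y = 0 := by
    by_contra h
    have h1 := minpoly.coeff_zero_ne_zero hyint h
    have h2 := congrArg ε (minpoly.aeval K y)
    rw [← Polynomial.aeval_algHom_apply, hεy, map_zero, Polynomial.aeval_def,
      Polynomial.eval₂_at_zero] at h2
    exact h1 h2
  rw [sub_eq_zero.1 hy0, ← IsScalarTower.algebraMap_apply]
  exact IntermediateField.algebraMap_mem _ _

end Specialization

/-! ### Rational function fields over `K` and over `𝔽₂` -/

section FunctionField

variable {K W : Type*} [Field K] [AddCommGroup W] [Module K W]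

theorem isIntegrallyClosed_symmetricAlgebra : IsIntegrallyClosed (SymmetricAlgebra K W) := by
  let b := Module.Free.chooseBasis K W
  have : UniqueFactorizationMonoid (SymmetricAlgebra K W) :=
    (SymmetricAlgebra.equivMvPolynomial b).symm.toMulEquiv.uniqueFactorizationMonoid inferInstance
  infer_instance

theorem exists_algHom_ne_zero (F : Type*) [Field F] [Infinite F] [Algebra K F]
    {r : SymmetricAlgebra K W} (hr : r ≠ 0) : ∃ f : SymmetricAlgebra K W →ₐ[K] F, f r ≠ 0 := by
  let b := Module.Free.chooseBasis K W
  let e := SymmetricAlgebra.equivMvPolynomial b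
  by_contra! h
  apply hr
  apply e.injective
  apply MvPolynomial.map_injective _ (algebraMap K F).injective
  rw [map_zero, map_zero]
  apply MvPolynomial.funext
  intro a
  have := h ((MvPolynomial.aeval a).comp e.toAlgHom)
  rw [MvPolynomial.eval_map, map_zero]
  exact this

theorem isAlgebraic_mem_bot {x : FractionRing (SymmetricAlgebra K W)} (hx : IsAlgebraic K x) :
    x ∈ (⊥ : IntermediateField K (FractionRing (SymmetricAlgebra K W))) :=
  have := isIntegrallyClosed_symmetricAlgebra (K := K) (W := W)
  mem_bot_of_isAlgebraic (R := SymmetricAlgebra K W) SymmetricAlgebra.algebraMapInv hx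

theorem ratFunc_transcendental_of_ne {y : RatFunc (ZMod 2)} (h0 : y ≠ 0) (h1 : y ≠ 1) :
    Transcendental (ZMod 2) y := by
  apply RatFunc.transcendental_of_ne_C
  rintro ⟨c, rfl⟩
  have h01 : ∀ a : ZMod 2, a = 0 ∨ a = 1 := by decide
  rcases h01 c with rfl | rfl
  · exact h0 (map_zero _)
  · exact h1 (map_one _)

/-- Every field of algebraic elements over `𝔽₂(x)` in a rational function field over `𝔽₂` embeds
into the function field of the line. -/
theorem exists_algHom_ratFunc {W : Type*} [AddCommGroup W] [Module (ZMod 2) W]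
    {x : FractionRing (SymmetricAlgebra (ZMod 2) W)} (hx : Transcendental (ZMod 2) x)
    (M : IntermediateField (ZMod 2) (FractionRing (SymmetricAlgebra (ZMod 2) W)))
    (hM : ∀ m ∈ M, IsAlgebraic (ZMod 2)⟮x⟯ m) : Nonempty (M →ₐ[ZMod 2] RatFunc (ZMod 2)) := by
  have := isIntegrallyClosed_symmetricAlgebra (K := ZMod 2) (W := W)
  obtain ⟨p, q, hq, rfl⟩ := IsFractionRing.div_surjective (SymmetricAlgebra (ZMod 2) W) x
  have hq0 : q ≠ 0 := nonZeroDivisors.ne_zero hq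
  have hp0 : p ≠ 0 := by
    rintro rfl
    rw [map_zero, zero_div] at hx
    exact hx isAlgebraic_zero
  have hpq : p - q ≠ 0 := by
    intro h
    rw [sub_eq_zero.1 h, div_self (by rwa [Ne, IsFractionRing.to_map_eq_zero_iff])] at hx
    exact hx isAlgebraic_one
  have : Infinite (RatFunc (ZMod 2)) :=
    Infinite.of_injective _ (RatFunc.algebraMap_injective (ZMod 2))
  -- Nonvanishing of `p`, `q` and `p - q` keeps the value of `x` away from 0 and 1, the only
  -- constants of `𝔽₂(t)`.
  obtain ⟨f, hf⟩ := exists_algHom_ne_zero (RatFunc (ZMod 2)) (mul_ne_zero (mul_ne_zero hp0 hq0) hpq)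
  rw [map_mul, map_mul, map_sub] at hf
  have hfp := left_ne_zero_of_mul (left_ne_zero_of_mul hf)
  have hfq := right_ne_zero_of_mul (left_ne_zero_of_mul hf)
  have hfpq := right_ne_zero_of_mul hf
  exact exists_algHom_of_isAlgebraic f hfq (ratFunc_transcendental_of_ne (div_ne_zero hfp hfq)
    fun h => hfpq (sub_eq_zero.2 ((div_eq_one_iff_eq hfq).1 h))) M hM

end FunctionField

/-! ### Faithful action on an algebraic closure inside `L` -/

section LowerBound

variable {K L G : Type*} [Field K] [Field L] [Algebra K L] [Group G]

/-- If `L / L₀` is defined over `E₀` and `E₀` is algebraic over `K(x)`, then the algebraic closure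
of `K(x)` in `L` is stable under the action, and the action on it is faithful. -/
theorem exists_stable_of_extensionDefinedOver [Finite G] {θ : G →* (L ≃ₐ[K] L)}
    (hθ : Function.Injective θ) {E₀ : IntermediateField K L}
    (hE₀ : ExtensionDefinedOver (fixedField θ.range) E₀) {x : L} (hx : x ∈ E₀)
    (halg : ∀ y ∈ E₀, IsAlgebraic K⟮x⟯ y) :
    ∃ M : IntermediateField K L, (∀ m ∈ M, IsAlgebraic K⟮x⟯ m) ∧
      (∀ g, ∀ m ∈ M, θ g m ∈ M) ∧ ∀ g, (∀ m ∈ M, θ g m = m) → g = 1 := by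
  obtain ⟨hle, E, hE, hdeg, hsup⟩ := hE₀
  let N := algebraicClosure K⟮x⟯ L
  let M := N.restrictScalars K
  have hN : ∀ m, m ∈ M ↔ IsAlgebraic K⟮x⟯ m := fun m => mem_algebraicClosure_iff
  have hfix : ∀ g, ∀ y ∈ K⟮x⟯, θ g y = y := fun g y hy =>
    mem_fixedField_range.1 ((adjoin_simple_le_iff.2 hx).trans hle hy) g
  refine ⟨M, fun m => (hN m).1, fun g m hm => ?_, fun g hg => hθ ?_⟩
  · rw [hN] at hm ⊢
    obtain ⟨p, hp, hpm⟩ := hm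
    refine ⟨p, hp, ?_⟩
    rw [Polynomial.aeval_def] at hpm ⊢
    have h1 := congrArg (θ g : L →+* L) hpm
    rw [Polynomial.hom_eval₂, map_zero] at h1
    have h2 : (θ g : L →+* L).comp (algebraMap K⟮x⟯ L) = algebraMap K⟮x⟯ L :=
      RingHom.ext fun y => hfix g y y.2
    rw [h2] at h1
    exact h1
  · have hEM : E ≤ M := by
      intro e he
      -- The degree `|G|` is not the default value 0 of `finrank`, so `E / E₀` is finite.
      have h1 : Module.finrank E₀ (extendScalars hE) ≠ 0 := by
        rw [← relfinrank_eq_finrank_of_le, hdeg, finrank_fixedField_range hθ]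
        exact Nat.card_pos.ne'
      have : FiniteDimensional E₀ (extendScalars hE) := Module.finite_of_finrank_pos
        (Nat.pos_of_ne_zero h1)
      have h2 : IsAlgebraic E₀ e :=
        (Algebra.IsAlgebraic.isAlgebraic (R := E₀) (⟨e, he⟩ : extendScalars hE)).algebraMap
      have h3 : IsAlgebraic N e := IsAlgebraic.tower_top_of_subalgebra_le
        (A := E₀.toSubalgebra) (B := M.toSubalgebra) (fun y hy => (hN y).2 (halg y hy)) h2
      exact (hN e).2 (h3.restrictScalars K⟮x⟯)
    -- An element acting trivially on `M` fixes both `E` and `L₀`, which generate `L`.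
    have h1 : θ g ∈ E.fixingSubgroup ⊓ (fixedField θ.range).fixingSubgroup := by
      refine ⟨(IntermediateField.mem_fixingSubgroup_iff _ _).2 fun e he => hg e (hEM he),
        (IntermediateField.mem_fixingSubgroup_iff _ _).2 fun y hy => mem_fixedField_range.1 hy g⟩
    rw [← fixingSubgroup_sup, hsup, IntermediateField.fixingSubgroup_top, Subgroup.mem_bot] at h1
    rw [h1, map_one]

theorem isAlgebraic_of_trdeg_le_one {E₀ : IntermediateField K L} (h : Algebra.trdeg K E₀ ≤ 1)
    {x : L} (hx : x ∈ E₀) (hxt : Transcendental K x) : ∀ y ∈ E₀, IsAlgebraic K⟮x⟯ y := by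
  let x' : Unit → E₀ := fun _ => ⟨x, hx⟩
  have hx' : AlgebraicIndependent K x' := by
    rw [algebraicIndependent_unique_type_iff]
    exact fun h => hxt (h.algebraMap (A := L))
  have hb := hx'.isTranscendenceBasis_of_lift_trdeg_le_of_finite (by simpa using h)
  intro y hy
  obtain ⟨p, hp, hpy⟩ := hb.isAlgebraic.isAlgebraic (⟨y, hy⟩ : E₀)
  have hle : Algebra.adjoin K (Set.range x') ≤ K⟮x⟯.toSubalgebra.comap E₀.val :=
    Algebra.adjoin_le (by
      rintro _ ⟨-, rfl⟩
      exact mem_adjoin_simple_self K x)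
  let i : Algebra.adjoin K (Set.range x') →+* K⟮x⟯ :=
    ((E₀.val.comp (Subalgebra.val _)).codRestrict K⟮x⟯.toSubalgebra fun a => hle a.2).toRingHom
  have hi : Function.Injective i := fun a b hab =>
    Subtype.ext (Subtype.ext (congrArg (fun z : K⟮x⟯ => (z : L)) hab))
  refine ⟨p.map i, (Polynomial.map_ne_zero_iff hi).2 hp, ?_⟩
  rw [Polynomial.aeval_def, Polynomial.eval₂_map]
  have h1 := congrArg (algebraMap E₀ L) hpy
  rw [Polynomial.aeval_def, Polynomial.hom_eval₂, map_zero] at h1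
  exact h1

end LowerBound

/-! ### Faithfulness on `K(V)` and positivity -/

section Representation

variable {K G V : Type*} [Field K] [Group G] [AddCommGroup V] [Module K V]

theorem functionFieldAction_injective {ρ : Representation K G V} (hρ : Function.Injective ρ) :
    Function.Injective (functionFieldAction ρ) := by
  rw [injective_iff_map_eq_one]
  intro g hg
  have h1 : ∀ f : Module.Dual K V, SymmetricAlgebra.ι K _ (ρ.dual g f) =
      SymmetricAlgebra.ι K _ f := by
    intro f
    apply IsFractionRing.injective (SymmetricAlgebra K (Module.Dual K V)) (AffineFunctionField K V)
    have h := DFunLike.congr_fun hg (algebraMap _ _ (SymmetricAlgebra.ι K _ f))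
    refine Eq.trans ?_ h
    refine Eq.trans ?_ (IsFractionRing.fieldEquivOfAlgEquiv_algebraMap (FA := K)
      (FB := AffineFunctionField K V) (FC := AffineFunctionField K V)
      (polynomialFunctionAction ρ g) (SymmetricAlgebra.ι K _ f)).symm
    congr 1
    change _ = SymmetricAlgebra.lift
      (SymmetricAlgebra.ι K (Module.Dual K V) ∘ₗ ρ.dual g) (SymmetricAlgebra.ι K _ f)
    rw [SymmetricAlgebra.lift_ι_apply, LinearMap.comp_apply]
  have h2 : ρ g⁻¹ = 1 := by
    ext v
    rw [← sub_eq_zero, ← Module.forall_dual_apply_eq_zero_iff K]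
    intro f
    rw [map_sub, sub_eq_zero]
    have := congrArg (SymmetricAlgebra.lift (Module.Dual.eval K V v)) (h1 f)
    rw [SymmetricAlgebra.lift_ι_apply, SymmetricAlgebra.lift_ι_apply] at this
    exact this
  exact inv_eq_one.1 (hρ (h2.trans (map_one ρ).symm))

theorem leftRegular_injective : Function.Injective (Representation.leftRegular K G) := by
  intro g h hgh
  have h1 := LinearMap.congr_fun hgh (MonoidAlgebra.single 1 1)
  rw [Representation.ofMulAction_single, Representation.ofMulAction_single] at h1
  have h2 := MonoidAlgebra.single_left_injective one_ne_zero h1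
  simpa using h2

theorem trdeg_ne_zero_of_extensionDefinedOver [Finite G] [Nontrivial G] {ρ : Representation K G V}
    (hρ : Function.Injective ρ) {E₀ : IntermediateField K (AffineFunctionField K V)}
    (hE₀ : ExtensionDefinedOver (invariantField ρ) E₀) : Algebra.trdeg K E₀ ≠ 0 := by
  intro h
  have halg := trdeg_eq_zero_iff.1 h
  -- With `x = 0` the base is `K` itself, which is algebraically closed in `K(V)`; so `M = K` and
  -- the action is trivial.
  obtain ⟨M, h1, -, h2⟩ := exists_stable_of_extensionDefinedOver
    (functionFieldAction_injective hρ) hE₀ (zero_mem E₀) fun y hy =>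
      IsAlgebraic.tower_top _ (IsAlgebraic.algebraMap (halg.isAlgebraic (⟨y, hy⟩ : E₀)))
  obtain ⟨g, hg⟩ := exists_ne (1 : G)
  refine hg (h2 g fun m hm => ?_)
  have h3 : IsAlgebraic K m := by
    have : Algebra.IsAlgebraic K K⟮(0 : AffineFunctionField K V)⟯ :=
      isAlgebraic_adjoin_simple isIntegral_zero
    exact (h1 m hm).restrictScalars K
  obtain ⟨c, rfl⟩ := mem_bot.1 (isAlgebraic_mem_bot h3)
  exact AlgEquiv.commutes _ c

theorem exists_eq_representationEssDim (ρ : Representation K G V) :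
    ∃ E₀, ExtensionDefinedOver (invariantField ρ) E₀ ∧
      representationEssDim ρ = Algebra.trdeg K E₀ :=
  csInf_mem (s := {d | ∃ E₀, ExtensionDefinedOver (invariantField ρ) E₀ ∧
      d = Algebra.trdeg K E₀}) ⟨_, invariantField ρ, ⟨le_rfl, ⊤, le_top, relfinrank_top_right _,
        top_sup_eq _⟩, rfl⟩

end Representation

/-! ### The two values for the Klein four-group -/

section KleinFour

theorem representationEssDim_kleinFour_of_four_le {K V : Type*} [Field K] [CharP K 2]
    (hK : 4 ≤ Cardinal.mk K) [AddCommGroup V] [Module K V]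
    {ρ : Representation K (Multiplicative (ZMod 2 × ZMod 2)) V} (hρ : Function.Injective ρ) :
    representationEssDim ρ = 1 := by
  apply le_antisymm
  · obtain ⟨c, hc0, hc1⟩ : ∃ c : K, c ≠ 0 ∧ c ≠ 1 := by
      by_contra! h
      have : Cardinal.mk K ≤ 2 := by
        have hinj : Function.Injective fun c : K => ULift.up (c = 0) := by
          intro a b hab
          replace hab : (a = 0) = (b = 0) := ULift.up_injective hab
          by_cases ha : a = 0
          · rw [ha, (cast hab ha : b = 0)]
          · rw [h a ha, h b fun hb => ha (cast hab.symm hb)]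
        simpa using Cardinal.mk_le_of_injective hinj
      exact absurd (hK.trans this) (by norm_num)
    let i := ZMod.castHom (dvd_refl 2) K
    have h01 : ∀ a : ZMod 2, a = 0 ∨ a = 1 := by decide
    have := extensionEssDim_le_of_characters (K := K)
      (L := AffineFunctionField K V) (G := Multiplicative (ZMod 2 × ZMod 2))
      (θ := functionFieldAction ρ) (functionFieldAction_injective hρ) 1
      -- Since `c ∉ 𝔽₂`, the elements 1 and `c` are independent over `𝔽₂`, so this character is
      -- injective.
      (fun _ (g : Multiplicative (ZMod 2 × ZMod 2)) => i g.toAdd.1 + i g.toAdd.2 * c)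
      (fun _ g h => by
        simp only [toAdd_mul, Prod.fst_add, Prod.snd_add, map_add]
        ring)
      (fun g hg => by
        obtain ⟨a, b⟩ := g
        have h := hg 0
        change i a + i b * c = 0 at h
        rcases h01 a with rfl | rfl <;> rcases h01 b with rfl | rfl
        · rfl
        · simp [hc0] at h
        · simp at h
        · rw [map_one, one_mul, CharTwo.add_eq_zero] at h
          exact absurd h.symm hc1)
    rw [Nat.cast_one] at this
    exact this
  · rw [Cardinal.one_le_iff_ne_zero]
    obtain ⟨E₀, h, h'⟩ := exists_eq_representationEssDim ρ
    rw [h']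
    exact trdeg_ne_zero_of_extensionDefinedOver hρ h

theorem representationEssDim_kleinFour_zmod_two {V : Type*} [AddCommGroup V] [Module (ZMod 2) V]
    {ρ : Representation (ZMod 2) (Multiplicative (ZMod 2 × ZMod 2)) V}
    (hρ : Function.Injective ρ) : representationEssDim ρ = 2 := by
  apply le_antisymm
  · have := extensionEssDim_le_of_characters (K := (ZMod 2))
      (L := AffineFunctionField (ZMod 2) V) (G := Multiplicative (ZMod 2 × ZMod 2))
      (θ := functionFieldAction ρ) (functionFieldAction_injective hρ) 2
      (fun i (g : Multiplicative (ZMod 2 × ZMod 2)) => if i = 0 then g.toAdd.1 else g.toAdd.2)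
      (fun i g h => by split_ifs <;> rfl)
      (fun g hg => Multiplicative.toAdd.injective
        (Prod.ext (by simpa using hg 0) (by simpa using hg 1)))
    exact_mod_cast this
  · obtain ⟨E₀, h, h'⟩ := exists_eq_representationEssDim ρ
    rw [h']
    have hne := trdeg_ne_zero_of_extensionDefinedOver hρ h
    by_contra! hlt
    have hle : Algebra.trdeg (ZMod 2) E₀ ≤ 1 := by
      obtain ⟨n, hn⟩ := Cardinal.lt_aleph0.1 (hlt.trans Cardinal.ofNat_lt_aleph0)
      rw [hn] at hlt ⊢
      have : n < 2 := by exact_mod_cast hlt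
      exact_mod_cast Nat.le_of_lt_succ this
    obtain ⟨x, hx, hxt⟩ : ∃ x ∈ E₀, Transcendental (ZMod 2) x := by
      by_contra! hall
      refine hne (trdeg_eq_zero_iff.2 ⟨fun y => ?_⟩)
      have := hall y y.2
      rw [Transcendental, not_not] at this
      exact (isAlgebraic_algebraMap_iff (algebraMap E₀ _).injective).1 this
    obtain ⟨M, h1, h2, h3⟩ := exists_stable_of_extensionDefinedOver
      (functionFieldAction_injective hρ) h hx (isAlgebraic_of_trdeg_le_one hle hx hxt)
    obtain ⟨j⟩ := exists_algHom_ratFunc hxt M h1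
    have hinj : Function.Injective (restrictAction (functionFieldAction ρ) M h2) := by
      rw [injective_iff_map_eq_one]
      intro g hg
      exact h3 g fun m hm => congrArg Subtype.val (DFunLike.congr_fun hg (⟨m, hm⟩ : M))
    exact not_injective_kleinFour_of_algHom_ratFunc j _ hinj

end KleinFour

/-- `Multiplicative (ZMod 2 × ZMod 2)` is the group `(ℤ/2ℤ)²`. As the essential dimension of a group
may be computed from any faithful representation, the values are asserted both for the regular
representation and for every finite-dimensional faithful one. -/
theorem proposition5p9 :
    (groupEssDim (ZMod 2) (Multiplicative (ZMod 2 × ZMod 2)) = 2 ∧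
      ∀ (V : Type*) [AddCommGroup V] [Module (ZMod 2) V] [FiniteDimensional (ZMod 2) V]
        (ρ : Representation (ZMod 2) (Multiplicative (ZMod 2 × ZMod 2)) V),
        Function.Injective ρ → representationEssDim ρ = 2) ∧
    (∀ (K : Type*) [Field K] [CharP K 2], 4 ≤ Cardinal.mk K →
      groupEssDim K (Multiplicative (ZMod 2 × ZMod 2)) = 1 ∧
      ∀ (V : Type*) [AddCommGroup V] [Module K V] [FiniteDimensional K V]
        (ρ : Representation K (Multiplicative (ZMod 2 × ZMod 2)) V),
        Function.Injective ρ → representationEssDim ρ = 1) :=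
  ⟨⟨representationEssDim_kleinFour_zmod_two leftRegular_injective,
      fun _ _ _ _ _ hρ => representationEssDim_kleinFour_zmod_two hρ⟩,
    fun _ _ _ hK => ⟨representationEssDim_kleinFour_of_four_le hK leftRegular_injective,
      fun _ _ _ _ _ hρ => representationEssDim_kleinFour_of_four_le hK hρ⟩⟩
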